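/- **Setting.** Let $J\subset\mathbb R^2$ be a Jordan curve (the image of a circle under a continuous injective map). For $p\notin J$ let $s_p$ be the maximal open vertical segment (possibly infinite) that contains $p$ and does not meet $J$. Let $\sim$ be the equivalence relation on such open segments generated by: $s\sim s'$ if some horizontal segment disjoint from $J$ joins a point of $s$ to a point of $s'$. Fix $p^*\in\mathbb R^2\setminus J$ such that no open segment in the class $[s_{p^*}]$ has infinite length. For a horizontal segment $t$ whose interior does not meet $J$, the horizontal sweep $H(t)$ is the union of the segments $s_p$, $p\in t\setminus J$. For a finite or infinite sequence of sweeps, the swept region $E$ is the union of the sweeps, and $K=\partial E$ is its boundary. Write $\mathcal V(K)$ for the set of vertical segments of $K$, i.e. open vertical segments that are contained in $K$, do not meet $J$ and have both endpoints on $J$. $K$ is a piecewise-vertical Jordan curve if it is a Jordan curve contained in the union of $J$ and the segments in $\mathcal V(K)$. For a closed set $K$, $\mathrm{ext}(K)$ denotes the set of points that lie in unbounded connected components of $\mathbb R^2\setminus K$. A sweepline algorithm started at $p^*$ is a non-empty finite or infinite sequence $(H(t_1),H(t_2),\dots)$ of sweeps such that $p^*\in\mathrm{int}(t_1)$ and,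 for each $i\ge 1$ for which $t_{i+1}$ is present, $t_{i+1}$ has one endpoint $m$ on some segment of $\mathcal V(K_i)$ and $t_{i+1}\setminus\{m\}\subset\mathrm{ext}(K_i)$, where $K_i$ is the boundary of the region swept by $H(t_1),\dots,H(t_i)$. It is maximal if its swept region is maximal under inclusion among the regions swept by sweepline algorithms started at $p^*$, and the boundary of its swept region is a piecewise-vertical Jordan curve that has no vertical segments. The greedy algorithm $\mathcal S_{greedy}$ takes for $t_1$ the horizontal segment with $p^*\in\mathrm{int}(t_1)$, $\mathrm{int}(t_1)\cap J=\emptyset$ and both endpoints on $J$. For $i=1,2,\dots$ it halts if $\mathcal V(K_i)=\emptyset$; otherwise it picks a segment $u_i\in\mathcal V(K_i)$ of maximum length, with midpoint $m_i$, and takes for $t_{i+1}$ a horizontal segment with one endpoint $m_i$, the other endpoint on $J$, $\mathrm{int}(t_{i+1})\cap J=\emptyset$ and $t_{i+1}\setminus\{m_i\}\subset\mathrm{ext}(K_i)$. **Theorem.** $\mathcal S_{greedy}$ is a maximal sweepline algorithm: for every execution of $\mathcal S_{greedy}$ (one that halts, or one that runs forever), with whatever choice among longest segments, the sequence of its sweeps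 is a sweepline algorithm started at $p^*$ whose swept region $E_{greedy}$ is maximal under inclusion among the regions swept by sweepline algorithms started at $p^*$, and $K_{greedy}=\partial E_{greedy}$ is a piecewise-vertical Jordan curve with $\mathcal V(K_{greedy})=\emptyset$. -/

import Mathlib

namespace Sweepline

/-- A Jordan curve: the image of the circle under a continuous injective map into the plane. -/
def IsJordanCurve (J : Set (ℝ × ℝ)) : Prop :=
  ∃ γ : Circle → ℝ × ℝ, Continuous γ ∧ Function.Injective γ ∧ Set.range γ = J

/-- `ext(K)`: the points off `K` whose connected component in the complement of `K` is
unbounded. -/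
def exterior (K : Set (ℝ × ℝ)) : Set (ℝ × ℝ) :=
  {p | p ∉ K ∧ ¬ Bornology.IsBounded (connectedComponentIn Kᶜ p)}

/-- `s_p`: the maximal open vertical segment through `p` that does not meet `J`
(it is empty when `p ∈ J`). -/
def openSeg (J : Set (ℝ × ℝ)) (p : ℝ × ℝ) : Set (ℝ × ℝ) :=
  {q | q.1 = p.1 ∧ Disjoint (segment ℝ p q) J}

/-- Two open vertical segments are adjacent if a horizontal segment that does not meet `J`
joins a point of one to a point of the other. -/
def HorizAdj (J s s' : Set (ℝ × ℝ)) : Prop :=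
  ∃ a b : ℝ × ℝ, a.2 = b.2 ∧ Disjoint (segment ℝ a b) J ∧ s = openSeg J a ∧ s' = openSeg J b

/-- The equivalence relation on open vertical segments generated by adjacency. -/
def SegEquiv (J : Set (ℝ × ℝ)) : Set (ℝ × ℝ) → Set (ℝ × ℝ) → Prop :=
  Relation.EqvGen (HorizAdj J)

/-- A nondegenerate horizontal segment. -/
structure HSeg where
  y : ℝ
  l : ℝ
  r : ℝ
  lt : l < r

namespace HSeg

def left (t : HSeg) : ℝ × ℝ := (t.l, t.y)

def right (t : HSeg) : ℝ × ℝ := (t.r, t.y)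

/-- The closed segment. -/
def carrier (t : HSeg) : Set (ℝ × ℝ) := Set.Icc t.l t.r ×ˢ {t.y}

/-- The segment without its endpoints. -/
def int (t : HSeg) : Set (ℝ × ℝ) := Set.Ioo t.l t.r ×ˢ {t.y}

end HSeg

/-- A nondegenerate vertical segment. -/
structure VSeg where
  x : ℝ
  lo : ℝ
  hi : ℝ
  lt : lo < hi

namespace VSeg

/-- The open segment. -/
def carrier (u : VSeg) : Set (ℝ × ℝ) := {u.x} ×ˢ Set.Ioo u.lo u.hi

def length (u : VSeg) : ℝ := u.hi - u.lo

noncomputable def midpoint (u : VSeg) : ℝ × ℝ := (u.x, (u.lo + u.hi) / 2)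

end VSeg

/-- `𝒱(K)`: the vertical segments of a curve `K` made of parts of `J` and of vertical segments.
They are the open vertical segments that lie in `K`, do not meet `J`, and have both endpoints
on `J`. -/
def verticalSegments (J K : Set (ℝ × ℝ)) : Set VSeg :=
  {u | u.carrier ⊆ K ∧ Disjoint u.carrier J ∧ (u.x, u.lo) ∈ J ∧ (u.x, u.hi) ∈ J}

/-- A piecewise-vertical Jordan curve (with respect to `J`): a Jordan curve all of whose points
lie on `J` or on one of its vertical segments. -/
def IsPiecewiseVertical (J K : Set (ℝ × ℝ)) : Prop :=
  IsJordanCurve K ∧ K ⊆ J ∪ ⋃ u ∈ verticalSegments J K, u.carrier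

/-- The region covered by the horizontal sweep `H(t)`: the union of the open segments `s_p`
over the points `p` of `t` that are not on `J`. -/
def sweep (J : Set (ℝ × ℝ)) (t : HSeg) : Set (ℝ × ℝ) :=
  ⋃ p ∈ t.carrier \ J, openSeg J p

/-- The region swept by the first `N ≤ ∞` sweeps `H(t 0), H(t 1), …`. -/
def swept (J : Set (ℝ × ℝ)) (t : ℕ → HSeg) (N : ℕ∞) : Set (ℝ × ℝ) :=
  ⋃ (i : ℕ) (_ : (i : ℕ∞) < N), sweep J (t i)

/-- The curve bounding the region swept by the first `N ≤ ∞` sweeps. -/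
def boundary (J : Set (ℝ × ℝ)) (t : ℕ → HSeg) (N : ℕ∞) : Set (ℝ × ℝ) :=
  frontier (swept J t N)

/-- `(H(t 0), H(t 1), …)`, with `N ≤ ∞` terms, is a sweepline algorithm started at `p`: the
interior of every `t i` avoids `J`, `p` lies in the interior of `t 0`, and every later `t (i + 1)`
has one endpoint `m` on a vertical segment of the boundary of the region swept so far, and apart
from `m` lies in the exterior of that boundary. Entries of `t` from `N` on play no role. -/
structure IsSweepline (J : Set (ℝ × ℝ)) (p : ℝ × ℝ) (t : ℕ → HSeg) (N : ℕ∞) : Prop where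
  pos : 0 < N
  start : p ∈ (t 0).int
  disj : ∀ i : ℕ, (i : ℕ∞) < N → Disjoint (t i).int J
  step : ∀ i : ℕ, ((i + 1 : ℕ) : ℕ∞) < N →
    ∃ u ∈ verticalSegments J (boundary J t (i + 1 : ℕ)), ∃ m ∈ u.carrier,
      ((t (i + 1)).left = m ∨ (t (i + 1)).right = m) ∧
      (t (i + 1)).carrier \ {m} ⊆ exterior (boundary J t (i + 1 : ℕ))

/-- An execution of the greedy sweepline algorithm started at `p`, with `N ≤ ∞` sweeps.
With `K i` the boundary of the region swept by `t 0, …, t i`, the segment `u i` is a vertical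
segment of `K i` of maximum length, and `t (i + 1)` runs from the midpoint of `u i`, in the
exterior of `K i`, to the first point of `J`. The execution is finite only if it halts because
there is no vertical segment left. -/
structure IsGreedyRun (J : Set (ℝ × ℝ)) (p : ℝ × ℝ) (t : ℕ → HSeg) (u : ℕ → VSeg) (N : ℕ∞) :
    Prop where
  pos : 0 < N
  start : p ∈ (t 0).int
  start_left : (t 0).left ∈ J
  start_right : (t 0).right ∈ J
  disj : ∀ i : ℕ, (i : ℕ∞) < N → Disjoint (t i).int J
  mem : ∀ i : ℕ, ((i + 1 : ℕ) : ℕ∞) < N →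
    u i ∈ verticalSegments J (boundary J t (i + 1 : ℕ))
  longest : ∀ i : ℕ, ((i + 1 : ℕ) : ℕ∞) < N →
    ∀ v ∈ verticalSegments J (boundary J t (i + 1 : ℕ)), v.length ≤ (u i).length
  endpoints : ∀ i : ℕ, ((i + 1 : ℕ) : ℕ∞) < N →
    ((t (i + 1)).left = (u i).midpoint ∧ (t (i + 1)).right ∈ J) ∨
    ((t (i + 1)).right = (u i).midpoint ∧ (t (i + 1)).left ∈ J)
  outside : ∀ i : ℕ, ((i + 1 : ℕ) : ℕ∞) < N →
    (t (i + 1)).carrier \ {(u i).midpoint} ⊆ exterior (boundary J t (i + 1 : ℕ))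
  halt : ∀ n : ℕ, N = n → verticalSegments J (boundary J t n) = ∅

/-- The regions swept by the sweepline algorithms started at `p`. -/
def IsSweptRegion (J : Set (ℝ × ℝ)) (p : ℝ × ℝ) (E : Set (ℝ × ℝ)) : Prop :=
  ∃ (t : ℕ → HSeg) (N : ℕ∞), IsSweepline J p t N ∧ E = swept J t N

/-- A maximal sweepline algorithm: a sweepline algorithm that no other one started at the same
point can outdo (its swept region is maximal under inclusion), and whose boundary is a
piecewise-vertical Jordan curve without vertical segments. -/
structure IsMaximalSweepline (J : Set (ℝ × ℝ)) (p : ℝ × ℝ) (t : ℕ → HSeg) (N : ℕ∞) : Prop where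
  isSweepline : IsSweepline J p t N
  maximal : Maximal (IsSweptRegion J p) (swept J t N)
  piecewiseVertical : IsPiecewiseVertical J (boundary J t N)
  noVertical : verticalSegments J (boundary J t N) = ∅

end Sweepline

/-!
Let `U` be the connected component of `p` in the complement of `J`. Every open segment `s_q` with
`q ∈ U` is equivalent to `s_p`, hence bounded with endpoints on `J`, so `U` lies in the convex hull
of `J`. Every sweepline algorithm started at `p` stays inside `U`; it remains to see that the
region `E` swept by a greedy run is all of `U` and that `∂U = J`.

A swept region is a union of segments `s_q`, and hence so is its boundary off `J`. If a greedy run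
halts, this gives `∂E ⊆ J`. If it runs forever, the lengths of the segments `u i` are not bounded
away from zero: otherwise infinitely many of the sweeps leave in the same direction from the
midpoints of long segments, and since `J` is locally connected, some box spanned by two of these
midpoints misses `J`, so that the later sweep would run into the earlier one. As `u i` is the
longest segment of `∂E_i`, a point of `∂E` off `J` would bound the lengths of the `u i` from below,
so again `∂E ⊆ J`. Now `E` is relatively closed and open in `U`, so `E = U`.

Finally, if `∂U` missed a point of `J`, it would lie on an arc. By Tietze's theorem there would be a
map of the plane into `J` fixing `∂U` pointwise; following it on the closure of `U` and the identity
elsewhere gives a self-map of the plane that is the identity off a bounded set and misses `U`. No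
such map exists, because its difference with a missed point would have a continuous logarithm.
-/

namespace Sweepline

open Set Filter Topology

section Topology

variable {X : Type*} [TopologicalSpace X]

theorem subset_interior_of_disjoint_frontier {C E : Set X}
    (hC : IsPreconnected C) (hd : Disjoint C (frontier E)) (hne : (C ∩ E).Nonempty) :
    C ⊆ interior E := by
  have hcl {x : X} (hx : x ∈ C) (hxE : x ∈ closure E) : x ∈ interior E :=
    not_not.1 fun hxi => disjoint_left.1 hd hx ⟨hxE, hxi⟩
  obtain ⟨x, hxC, hxE⟩ := hne
  exact hC.subset_of_closure_inter_subset isOpen_interior ⟨x, hxC, hcl hxC (subset_closure hxE)⟩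
    fun y hy => hcl hy.2 (closure_mono interior_subset hy.1)

theorem mem_connectedComponentIn_of_mem_closure {F : Set X} {x y : X}
    (hy : y ∈ closure (connectedComponentIn F x)) (hyF : y ∈ F) :
    y ∈ connectedComponentIn F x := by
  have hx : x ∈ F := connectedComponentIn_nonempty_iff.1 (closure_nonempty_iff.1 ⟨y, hy⟩)
  have hpre : IsPreconnected (insert y (connectedComponentIn F x)) :=
    isPreconnected_connectedComponentIn.subset_closure (subset_insert _ _)
      (insert_subset hy subset_closure)
  exact hpre.subset_connectedComponentIn (mem_insert_of_mem _ (mem_connectedComponentIn hx))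
    (insert_subset hyF (connectedComponentIn_subset F x)) (mem_insert _ _)

theorem eq_connectedComponentIn_of_disjoint_frontier {E F : Set X} {x : X} (hx : x ∈ E)
    (hEF : E ⊆ connectedComponentIn F x) (hfr : Disjoint F (frontier E)) :
    E = connectedComponentIn F x := by
  refine hEF.antisymm (Subset.trans ?_ interior_subset)
  exact subset_interior_of_disjoint_frontier isPreconnected_connectedComponentIn
    (hfr.mono_left (connectedComponentIn_subset F x)) ⟨x, hEF hx, hx⟩

theorem exists_Ioo_disjoint_of_notMem_isClosed {α : Type*} [ConditionallyCompleteLinearOrder α]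
    [TopologicalSpace α] [OrderTopology α] {S : Set α} (hS : IsClosed S) {y a b : α} (hy : y ∉ S)
    (ha : a ∈ S) (hay : a ≤ y) (hb : b ∈ S) (hyb : y ≤ b) :
    ∃ lo ∈ S, ∃ hi ∈ S, y ∈ Ioo lo hi ∧ Disjoint (Ioo lo hi) S := by
  obtain ⟨⟨hlo, hloy⟩, hlomax⟩ := (hS.inter isClosed_Iic).isGreatest_csSup ⟨a, ha, hay⟩
    (bddAbove_Iic.mono inter_subset_right)
  obtain ⟨⟨hhi, hyhi⟩, hhimin⟩ := (hS.inter isClosed_Ici).isLeast_csInf ⟨b, hb, hyb⟩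
    (bddBelow_Ici.mono inter_subset_right)
  refine ⟨_, hlo, _, hhi, ⟨hloy.lt_of_ne (ne_of_mem_of_not_mem hlo hy),
    hyhi.lt_of_ne (ne_of_mem_of_not_mem hhi hy).symm⟩, disjoint_left.2 fun z hz hzS => ?_⟩
  rcases le_total z y with hzy | hyz
  · exact hz.1.not_ge (hlomax ⟨hzS, hzy⟩)
  · exact hz.2.not_ge (hhimin ⟨hzS, hyz⟩)

theorem exists_ball_disjoint {X : Type*} [PseudoMetricSpace X] {F : Set X} (hF : IsClosed F)
    {x : X} (hx : x ∉ F) : ∃ δ > 0, Disjoint (Metric.ball x δ) F := by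
  obtain ⟨δ, hδ, hball⟩ := Metric.isOpen_iff.1 hF.isOpen_compl x hx
  exact ⟨δ, hδ, disjoint_left.2 hball⟩

theorem mk_mem_ball {X Y : Type*} [PseudoMetricSpace X] [PseudoMetricSpace Y] {a b c : X × Y}
    {δ : ℝ} (hb : b ∈ Metric.ball a δ) (hc : c ∈ Metric.ball a δ) :
    (b.1, c.2) ∈ Metric.ball a δ := by
  rw [← Prod.mk.eta (p := a), ← ball_prod_same] at hb hc ⊢
  exact ⟨hb.1, hc.2⟩

end Topology

section Retraction

theorem eq_add_mul_I_of_exp_eq_mul_exp_mul_I {l : ℝ → ℂ} (hl : Continuous l) {a : ℂ}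
    (h : ∀ θ : ℝ, Complex.exp (l θ) = a * Complex.exp (θ * Complex.I)) (θ : ℝ) :
    l θ = l 0 + θ * Complex.I := by
  have hexp (θ : ℝ) : Complex.exp (l θ - θ * Complex.I) = a := by
    rw [Complex.exp_sub, h, mul_div_cancel_right₀ _ (Complex.exp_ne_zero _)]
  have hconst : l θ - θ * Complex.I = l 0 - (0 : ℝ) * Complex.I :=
    Complex.isCoveringMap_exp.const_of_comp (g := fun θ : ℝ => l θ - θ * Complex.I)
      (by fun_prop) (fun _ _ => Subtype.ext ((hexp _).trans (hexp _).symm)) _ _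
  simpa [sub_eq_iff_eq_add] using hconst

theorem surjective_of_eq_self_off_bounded_complex {f : ℂ → ℂ} (hf : Continuous f) {B : Set ℂ}
    (hB : Bornology.IsBounded B) (hfB : ∀ z ∉ B, f z = z) : Function.Surjective f := by
  intro p
  by_contra! hp
  have hne (z : ℂ) : f z - p ≠ 0 := sub_ne_zero.2 (hp z)
  obtain ⟨L, ⟨-, hL⟩, -⟩ := Complex.isCoveringMapOn_exp.existsUnique_continuousMap_lifts
    ⟨fun z => f z - p, by fun_prop⟩ (Complex.exp_log (hne 0)) hne
  obtain ⟨R, hBR⟩ := hB.subset_ball p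
  have hcircle (θ : ℝ) : Complex.exp (L (circleMap p R θ)) = R * Complex.exp (θ * Complex.I) := by
    have hnot : circleMap p R θ ∉ B := fun h => circleMap_notMem_ball p R θ (hBR h)
    simpa [hfB _ hnot, circleMap_zero] using congrFun hL (circleMap p R θ)
  -- The logarithm `L` of `f - p` gains `2πi` along a closed curve.
  have hturn := eq_add_mul_I_of_exp_eq_mul_exp_mul_I (by fun_prop) hcircle (2 * Real.pi)
  have hper : circleMap p R (2 * Real.pi) = circleMap p R 0 := by
    simpa using periodic_circleMap p R 0
  simp [hper] at hturn

variable {E : Type*} [NormedAddCommGroup E] [NormedSpace ℝ E]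

theorem surjective_of_eq_self_off_bounded (e : E ≃L[ℝ] ℂ) {f : E → E} (hf : Continuous f)
    {B : Set E} (hB : Bornology.IsBounded B) (hfB : ∀ z ∉ B, f z = z) :
    Function.Surjective f := by
  have hconj : Function.Surjective (e ∘ f ∘ e.symm) :=
    surjective_of_eq_self_off_bounded_complex (by fun_prop) (e.lipschitz.isBounded_image hB)
      fun z hz => by
        rw [Function.comp_apply, Function.comp_apply, hfB, e.apply_symm_apply]
        exact fun h => hz ⟨_, h, e.apply_symm_apply z⟩
  simpa using hconj

theorem subset_image_closure_of_eqOn_frontier (e : E ≃L[ℝ] ℂ) {U : Set E}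
    (hU : Bornology.IsBounded U) {r : E → E} (hr : ContinuousOn r (closure U))
    (hfr : EqOn r id (frontier U)) : closure U ⊆ r '' closure U := by
  classical
  intro p hp
  have hcont : Continuous ((closure U).piecewise r id) :=
    continuous_piecewise (fun z hz => hfr (frontier_closure_subset hz)) (by simpa using hr)
      continuousOn_id
  obtain ⟨z, hz⟩ := surjective_of_eq_self_off_bounded e hcont hU.closure
    (fun z hz => piecewise_eq_of_notMem _ _ _ hz) p
  by_cases hzU : z ∈ closure U
  · exact ⟨z, hzU, by rwa [piecewise_eq_of_mem _ _ _ hzU] at hz⟩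
  · rw [piecewise_eq_of_notMem _ _ _ hzU, id] at hz
    exact absurd (hz ▸ hp) hzU

theorem circle_coe_mem_slitPlane {b : Circle} (hb : b ≠ Circle.exp Real.pi) :
    (b : ℂ) ∈ Complex.slitPlane := by
  refine Complex.mem_slitPlane_iff_arg.2 ⟨fun harg => hb ?_, b.coe_ne_zero⟩
  rw [← harg, Circle.exp_arg]

theorem exists_continuous_retraction_of_range_circle {X : Type*} [TopologicalSpace X] [T4Space X]
    {γ : Circle → X} (hγ : Continuous γ) (hinj : Function.Injective γ) {A : Set X}
    (hA : IsClosed A) (hAγ : A ⊆ range γ) {w : Circle} (hw : γ w ∉ A) :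
    ∃ r : X → X, Continuous r ∧ range r ⊆ range γ ∧ EqOn r id A := by
  let param : Circle ≃ₜ range γ := (hγ.isClosedEmbedding hinj).isEmbedding.toHomeomorph
  let β : A → Circle := fun z => param.symm ⟨z, hAγ z.2⟩
  have hβ (z : A) : γ (β z) = z := congrArg Subtype.val (param.apply_symm_apply ⟨z, hAγ z.2⟩)
  -- Rotating `w` onto the branch cut makes the argument continuous on `A`, so Tietze applies to it.
  let b : A → Circle := fun z => Circle.exp Real.pi * (β z / w)
  have hslit (z : A) : (b z : ℂ) ∈ Complex.slitPlane := by
    refine circle_coe_mem_slitPlane fun hz => hw ?_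
    have hzw : β z = w := div_eq_one.1 (mul_eq_left.1 hz)
    rw [← hzw, hβ]
    exact z.2
  let angle : C(A, ℝ) := ⟨fun z => Complex.arg (b z), continuous_iff_continuousAt.2 fun z =>
    (Complex.continuousAt_arg (hslit z)).comp (f := fun z : A => (b z : ℂ)) (by fun_prop)⟩
  obtain ⟨Φ, hΦ⟩ := angle.exists_restrict_eq hA
  refine ⟨fun z => γ ((Circle.exp Real.pi)⁻¹ * Circle.exp (Φ z) * w), by fun_prop, ?_, ?_⟩
  · rintro _ ⟨z, rfl⟩
    exact mem_range_self _
  · intro z hz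
    have hΦz : Φ z = Complex.arg (b ⟨z, hz⟩) := DFunLike.congr_fun hΦ ⟨z, hz⟩
    simp only [hΦz, Circle.exp_arg, b, inv_mul_cancel_left, div_mul_cancel, hβ, id]

end Retraction

theorem IsJordanCurve.isCompact {J : Set (ℝ × ℝ)} (hJ : IsJordanCurve J) : IsCompact J := by
  obtain ⟨γ, hγ, -, rfl⟩ := hJ
  exact isCompact_range hγ

theorem IsJordanCurve.locallyConnectedSpace {J : Set (ℝ × ℝ)} (hJ : IsJordanCurve J) :
    LocallyConnectedSpace J := by
  obtain ⟨γ, hγ, hinj, rfl⟩ := hJ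
  have : LocallyConnectedSpace Circle :=
    ChartedSpace.locallyConnectedSpace (EuclideanSpace ℝ (Fin 1)) Circle
  exact (hγ.isClosedEmbedding hinj).isEmbedding.toHomeomorph.symm.locallyConnectedSpace

theorem IsJordanCurve.subset_frontier {J U : Set (ℝ × ℝ)} (hJ : IsJordanCurve J)
    (hUJ : Disjoint U J) (hU : Bornology.IsBounded U) (hne : U.Nonempty)
    (hfr : frontier U ⊆ J) : J ⊆ frontier U := by
  obtain ⟨γ, hγ, hinj, rfl⟩ := hJ
  rintro _ ⟨w, rfl⟩
  by_contra hw
  obtain ⟨r, hr, hrange, hid⟩ :=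
    exists_continuous_retraction_of_range_circle hγ hinj isClosed_frontier hfr hw
  obtain ⟨q, hq⟩ := hne
  obtain ⟨z, -, hz⟩ := subset_image_closure_of_eqOn_frontier Complex.equivRealProdCLM.symm hU
    hr.continuousOn hid (subset_closure hq)
  exact disjoint_left.1 hUJ hq (hrange ⟨z, hz⟩)

section OpenSeg

variable {J : Set (ℝ × ℝ)} {p q r : ℝ × ℝ}

theorem mem_openSeg_iff :
    q ∈ openSeg J p ↔ q.1 = p.1 ∧ ∀ y ∈ uIcc p.2 q.2, (p.1, y) ∉ J := by
  obtain ⟨a, b⟩ := p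
  obtain ⟨a', b'⟩ := q
  refine and_congr_right fun h => ?_
  obtain rfl : a' = a := h
  rw [← Prod.image_mk_segment_right, segment_eq_uIcc, disjoint_left, forall_mem_image]

theorem mem_openSeg_self (hp : p ∉ J) : p ∈ openSeg J p := by
  simp [mem_openSeg_iff, hp]

theorem mem_openSeg_symm (h : q ∈ openSeg J p) : p ∈ openSeg J q :=
  ⟨h.1.symm, segment_symm ℝ p q ▸ h.2⟩

theorem notMem_of_mem_openSeg (h : q ∈ openSeg J p) : q ∉ J :=
  disjoint_left.1 h.2 (right_mem_segment ℝ p q)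

theorem mem_openSeg_trans (hpq : q ∈ openSeg J p) (hqr : r ∈ openSeg J q) : r ∈ openSeg J p := by
  rw [mem_openSeg_iff] at hpq hqr ⊢
  refine ⟨hqr.1.trans hpq.1, fun y hy => ?_⟩
  rcases uIcc_subset_uIcc_union_uIcc (b := q.2) hy with hy | hy
  · exact hpq.2 y hy
  · exact hpq.1 ▸ hqr.2 y hy

theorem openSeg_eq_of_mem (h : q ∈ openSeg J p) : openSeg J q = openSeg J p :=
  Subset.antisymm (fun _ hr => mem_openSeg_trans h hr)
    fun _ hr => mem_openSeg_trans (mem_openSeg_symm h) hr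

theorem mem_openSeg_of_convex {B : Set (ℝ × ℝ)} (hB : Convex ℝ B) (hBJ : Disjoint B J)
    (hp : p ∈ B) (hq : q ∈ B) (h : q.1 = p.1) : q ∈ openSeg J p :=
  ⟨h, hBJ.mono_left (hB.segment_subset hp hq)⟩

theorem openSeg_subset_connectedComponentIn (J : Set (ℝ × ℝ)) (p : ℝ × ℝ) :
    openSeg J p ⊆ connectedComponentIn Jᶜ p := fun q hq =>
  (convex_segment p q).isPreconnected.subset_connectedComponentIn (left_mem_segment ℝ p q)
    (disjoint_left.1 hq.2) (right_mem_segment ℝ p q)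

theorem eventually_add_mem_openSeg (hJ : IsClosed J) (h : q ∈ openSeg J p) :
    ∀ᶠ v in 𝓝 (0 : ℝ × ℝ), q + v ∈ openSeg J (p + v) := by
  have hcompact : IsCompact (segment ℝ p q) := by
    rw [segment_eq_image_lineMap]
    exact isCompact_Icc.image AffineMap.lineMap_continuous
  obtain ⟨δ, hδ, hsub⟩ :=
    hcompact.exists_thickening_subset_open hJ.isOpen_compl (disjoint_left.1 h.2)
  filter_upwards [Metric.ball_mem_nhds (0 : ℝ × ℝ) hδ] with v hv
  refine ⟨by simp [h.1], disjoint_left.2 fun z hz => hsub ?_⟩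
  rw [add_comm p, add_comm q, ← segment_translate_image] at hz
  obtain ⟨w, hw, rfl⟩ := hz
  exact Metric.mem_thickening_iff.2 ⟨w, hw, by simpa [dist_eq_norm] using hv⟩

theorem exists_ge_mem_of_isBounded_openSeg (hb : Bornology.IsBounded (openSeg J p)) :
    ∃ y ≥ p.2, (p.1, y) ∈ J := by
  by_contra! hJ
  have hray : Ici p.2 ⊆ Prod.snd '' openSeg J p := fun y (hy : p.2 ≤ y) =>
    ⟨(p.1, y), mem_openSeg_iff.2 ⟨rfl, fun z hz => hJ z (uIcc_of_le hy ▸ hz).1⟩, rfl⟩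
  exact not_bddAbove_Ici p.2 (hb.image_snd.bddAbove.mono hray)

theorem exists_le_mem_of_isBounded_openSeg (hb : Bornology.IsBounded (openSeg J p)) :
    ∃ y ≤ p.2, (p.1, y) ∈ J := by
  by_contra! hJ
  have hray : Iic p.2 ⊆ Prod.snd '' openSeg J p := fun y (hy : y ≤ p.2) =>
    ⟨(p.1, y), mem_openSeg_iff.2 ⟨rfl, fun z hz => hJ z (uIcc_of_ge hy ▸ hz).2⟩, rfl⟩
  exact not_bddBelow_Iic p.2 (hb.image_snd.bddBelow.mono hray)

theorem mem_convexHull_of_isBounded_openSeg (hb : Bornology.IsBounded (openSeg J p)) :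
    p ∈ convexHull ℝ J := by
  obtain ⟨lo, hlo, hloJ⟩ := exists_le_mem_of_isBounded_openSeg hb
  obtain ⟨hi, hhi, hhiJ⟩ := exists_ge_mem_of_isBounded_openSeg hb
  refine segment_subset_convexHull hloJ hhiJ ?_
  rw [← Prod.image_mk_segment_right, segment_eq_Icc (hlo.trans hhi)]
  exact ⟨p.2, ⟨hlo, hhi⟩, rfl⟩

theorem openSeg_eq_carrier {v : VSeg} (hd : Disjoint v.carrier J) (hlo : (v.x, v.lo) ∈ J)
    (hhi : (v.x, v.hi) ∈ J) (hp : p ∈ v.carrier) : openSeg J p = v.carrier := by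
  obtain ⟨x, y⟩ := p
  obtain ⟨rfl, hy⟩ : x = v.x ∧ y ∈ Ioo v.lo v.hi := hp
  refine Subset.antisymm ?_ fun q hq =>
    mem_openSeg_of_convex ((convex_singleton _).prod (convex_Ioo _ _)) hd ⟨rfl, hy⟩ hq hq.1
  intro q hq
  rw [mem_openSeg_iff] at hq
  refine ⟨hq.1, ?_, ?_⟩
  · by_contra! hle
    exact hq.2 v.lo (mem_uIcc.2 (Or.inr ⟨hle, hy.1.le⟩)) hlo
  · by_contra! hle
    exact hq.2 v.hi (mem_uIcc.2 (Or.inl ⟨hy.2.le, hle⟩)) hhi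

theorem exists_verticalSegment_carrier_eq_openSeg (hJ : IsClosed J) (hp : p ∉ J)
    (hb : Bornology.IsBounded (openSeg J p)) :
    ∃ v : VSeg, v.carrier = openSeg J p ∧ (v.x, v.lo) ∈ J ∧ (v.x, v.hi) ∈ J := by
  obtain ⟨a, ha, haJ⟩ := exists_le_mem_of_isBounded_openSeg hb
  obtain ⟨b, hb, hbJ⟩ := exists_ge_mem_of_isBounded_openSeg hb
  have hclosed : IsClosed {y : ℝ | (p.1, y) ∈ J} := hJ.preimage (by fun_prop)
  obtain ⟨lo, hlo, hi, hhi, hy, hd⟩ :=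
    exists_Ioo_disjoint_of_notMem_isClosed hclosed (y := p.2) hp haJ ha hbJ hb
  let v : VSeg := ⟨p.1, lo, hi, hy.1.trans hy.2⟩
  have hvJ : Disjoint v.carrier J := by
    rw [disjoint_left]
    rintro ⟨_, y⟩ ⟨rfl, hyv⟩
    exact disjoint_left.1 hd hyv
  exact ⟨v, (openSeg_eq_carrier hvJ hlo hhi ⟨rfl, hy⟩).symm, hlo, hhi⟩

end OpenSeg

section Saturated

variable {J E : Set (ℝ × ℝ)}

/-- A set is saturated if it contains the maximal open vertical segment `s_p` of each of its
points `p`, as every swept region does. -/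
def Saturated (J E : Set (ℝ × ℝ)) : Prop := ∀ p ∈ E, openSeg J p ⊆ E

theorem Saturated.compl (h : Saturated J E) : Saturated J Eᶜ :=
  fun _ hp _ hq hqE => hp (h _ hqE (mem_openSeg_symm hq))

theorem Saturated.closure (hJ : IsClosed J) (h : Saturated J E) : Saturated J (closure E) := by
  intro p hp q hq
  have hsub : Tendsto (fun x : ℝ × ℝ => x - p) (𝓝 p) (𝓝 0) :=
    Continuous.tendsto' (by fun_prop) p 0 (sub_self p)
  have hadd : Tendsto (fun x : ℝ × ℝ => q + (x - p)) (𝓝 p) (𝓝 q) :=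
    Continuous.tendsto' (by fun_prop) p q (by simp)
  rw [mem_closure_iff_frequently] at hp ⊢
  refine hadd.frequently ((hp.and_eventually
    (hsub.eventually (eventually_add_mem_openSeg hJ hq))).mono fun x ⟨hxE, hx⟩ => ?_)
  rw [add_sub_cancel] at hx
  exact h x hxE hx

theorem Saturated.frontier (hJ : IsClosed J) (h : Saturated J E) : Saturated J (frontier E) := by
  intro p hp q hq
  rw [frontier_eq_closure_inter_closure] at hp ⊢
  exact ⟨h.closure hJ p hp.1 hq, h.compl.closure hJ p hp.2 hq⟩

theorem Saturated.exists_verticalSegment (hJ : IsClosed J) (hE : Saturated J E)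
    (hb : Bornology.IsBounded E) {q : ℝ × ℝ} (hq : q ∈ _root_.frontier E) (hqJ : q ∉ J) :
    ∃ v ∈ verticalSegments J (_root_.frontier E), v.carrier = openSeg J q := by
  have hsub := hE.frontier hJ q hq
  obtain ⟨v, hv, hlo, hhi⟩ := exists_verticalSegment_carrier_eq_openSeg hJ hqJ
    (hb.closure.subset (hsub.trans frontier_subset_closure))
  exact ⟨v, ⟨hv ▸ hsub, hv ▸ disjoint_left.2 fun _ => notMem_of_mem_openSeg, hlo, hhi⟩, hv⟩

theorem Saturated.exists_verticalSegment_length_ge (hJ : IsClosed J) (hE : Saturated J E)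
    (hb : Bornology.IsBounded E) {q : ℝ × ℝ} {c : ℝ} (hc : 0 < c)
    (hball : Disjoint (Metric.ball q c) J)
    (hne : (Metric.ball q c ∩ _root_.frontier E).Nonempty) :
    ∃ v ∈ verticalSegments J (_root_.frontier E), 2 * c ≤ v.length := by
  obtain ⟨w, hwq, hw⟩ := hne
  obtain ⟨v, hv, hvw⟩ := hE.exists_verticalSegment hJ hb hw (disjoint_left.1 hball hwq)
  have hsub : Ioo (q.2 - c) (q.2 + c) ⊆ Ioo v.lo v.hi := by
    intro y hy
    have hyq : (q.1, y) ∈ Metric.ball q c := by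
      rw [← Real.ball_eq_Ioo] at hy
      rw [← Prod.mk.eta (p := q), ← ball_prod_same]
      exact ⟨Metric.mem_ball_self hc, hy⟩
    have hyw : (w.1, y) ∈ openSeg J w :=
      mem_openSeg_of_convex (convex_ball q c) hball hwq (mk_mem_ball hwq hyq) rfl
    exact (hvw ▸ hyw : (w.1, y) ∈ v.carrier).2
  obtain ⟨hlo, hhi⟩ := (Ioo_subset_Ioo_iff (by linarith)).1 hsub
  exact ⟨v, hv, by rw [VSeg.length]; linarith⟩

end Saturated

section Sweeps

variable {J : Set (ℝ × ℝ)} {t : ℕ → HSeg}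

theorem HSeg.int_subset_carrier (t : HSeg) : t.int ⊆ t.carrier :=
  prod_mono Ioo_subset_Icc_self subset_rfl

theorem HSeg.left_mem_carrier (t : HSeg) : t.left ∈ t.carrier :=
  ⟨left_mem_Icc.2 t.lt.le, rfl⟩

theorem HSeg.right_mem_carrier (t : HSeg) : t.right ∈ t.carrier :=
  ⟨right_mem_Icc.2 t.lt.le, rfl⟩

theorem HSeg.carrier_subset_closure_int (t : HSeg) : t.carrier ⊆ closure t.int := by
  rw [HSeg.int, closure_prod_eq, closure_Ioo t.lt.ne]
  exact prod_mono subset_rfl subset_closure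

theorem HSeg.isPreconnected_carrier_diff {t : HSeg} (ht : Disjoint t.int J) :
    IsPreconnected (t.carrier \ J) :=
  (isPreconnected_Ioo.prod isPreconnected_singleton).subset_closure
    (subset_sdiff.2 ⟨t.int_subset_carrier, ht⟩)
    (sdiff_subset.trans t.carrier_subset_closure_int)

theorem saturated_sweep (J : Set (ℝ × ℝ)) (t : HSeg) : Saturated J (sweep J t) := by
  intro p hp q hq
  obtain ⟨a, ha, hpa⟩ := mem_iUnion₂.1 hp
  exact mem_iUnion₂.2 ⟨a, ha, mem_openSeg_trans hpa hq⟩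

theorem saturated_swept (J : Set (ℝ × ℝ)) (t : ℕ → HSeg) (N : ℕ∞) :
    Saturated J (swept J t N) := by
  intro p hp q hq
  obtain ⟨i, hi, hpi⟩ := mem_iUnion₂.1 hp
  exact mem_iUnion₂.2 ⟨i, hi, saturated_sweep J (t i) p hpi hq⟩

theorem openSeg_subset_sweep {t : HSeg} {p : ℝ × ℝ} (hp : p ∈ t.carrier) :
    openSeg J p ⊆ sweep J t := fun _ hq =>
  mem_iUnion₂.2 ⟨p, ⟨hp, notMem_of_mem_openSeg (mem_openSeg_symm hq)⟩, hq⟩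

theorem sweep_subset_swept {N : ℕ∞} {i : ℕ} (h : (i : ℕ∞) < N) : sweep J (t i) ⊆ swept J t N :=
  subset_iUnion₂_of_subset i h subset_rfl

theorem swept_mono {M N : ℕ∞} (h : M ≤ N) : swept J t M ⊆ swept J t N :=
  iUnion₂_subset fun _ hi => sweep_subset_swept (hi.trans_le h)

theorem disjoint_exterior_frontier {E : Set (ℝ × ℝ)} (hE : Bornology.IsBounded E) :
    Disjoint E (exterior (frontier E)) := by
  refine disjoint_left.2 fun x hx hxe => hxe.2 (hE.subset (Subset.trans ?_ interior_subset))
  exact subset_interior_of_disjoint_frontier isPreconnected_connectedComponentIn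
    (disjoint_left.2 (connectedComponentIn_subset _ x)) ⟨x, mem_connectedComponentIn hxe.1, hx⟩

end Sweeps

section Component

variable {J : Set (ℝ × ℝ)} {p q : ℝ × ℝ} {t : ℕ → HSeg} {N : ℕ∞}

theorem segEquiv_of_ball_disjoint {δ : ℝ} (hball : Disjoint (Metric.ball p δ) J)
    (hq : q ∈ Metric.ball p δ) : SegEquiv J (openSeg J p) (openSeg J q) := by
  have hp : p ∈ Metric.ball p δ := Metric.mem_ball_self (Metric.pos_of_mem_ball hq)
  have hcorner : (p.1, q.2) ∈ Metric.ball p δ := mk_mem_ball hp hq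
  rw [← openSeg_eq_of_mem (mem_openSeg_of_convex (convex_ball p δ) hball hp hcorner rfl)]
  exact .rel _ _ ⟨(p.1, q.2), q, rfl,
    hball.mono_left ((convex_ball p δ).segment_subset hcorner hq), rfl, rfl⟩

theorem segEquiv_of_mem_connectedComponentIn (hJ : IsClosed J)
    (hq : q ∈ connectedComponentIn Jᶜ p) : SegEquiv J (openSeg J p) (openSeg J q) := by
  have hp : p ∈ Jᶜ := connectedComponentIn_nonempty_iff.1 ⟨q, hq⟩
  refine isPreconnected_connectedComponentIn.induction₂
    (fun x y => SegEquiv J (openSeg J x) (openSeg J y)) (fun x hx => ?_)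
    (fun _ _ _ _ _ _ h h' => .trans _ _ _ h h') (fun _ _ _ _ h => .symm _ _ h)
    (mem_connectedComponentIn hp) hq
  obtain ⟨δ, hδ, hball⟩ := exists_ball_disjoint hJ (connectedComponentIn_subset _ _ hx)
  filter_upwards [mem_nhdsWithin_of_mem_nhds (Metric.ball_mem_nhds x hδ)] with y hy
  exact segEquiv_of_ball_disjoint hball hy

theorem isBounded_connectedComponentIn (hJ : IsCompact J)
    (hfin : ∀ s, SegEquiv J (openSeg J p) s → Bornology.IsBounded s) :
    Bornology.IsBounded (connectedComponentIn Jᶜ p) :=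
  (isBounded_convexHull.2 hJ.isBounded).subset fun _ hq =>
    mem_convexHull_of_isBounded_openSeg
      (hfin _ (segEquiv_of_mem_connectedComponentIn hJ.isClosed hq))

theorem sweep_subset_connectedComponentIn {t : HSeg} (ht : Disjoint t.int J) (hqt : q ∈ t.carrier)
    (hq : q ∈ connectedComponentIn Jᶜ p) : sweep J t ⊆ connectedComponentIn Jᶜ p := by
  refine iUnion₂_subset fun z hz => (openSeg_subset_connectedComponentIn J z).trans ?_
  have hz' : z ∈ connectedComponentIn Jᶜ q :=
    (HSeg.isPreconnected_carrier_diff ht).subset_connectedComponentIn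
      ⟨hqt, connectedComponentIn_subset _ _ hq⟩ (fun _ hx => hx.2) hz
  rw [connectedComponentIn_eq hq, connectedComponentIn_eq hz']

theorem IsSweepline.start_notMem (h : IsSweepline J p t N) : p ∉ J :=
  disjoint_left.1 (h.disj 0 h.pos) h.start

theorem IsSweepline.mem_swept (h : IsSweepline J p t N) : p ∈ swept J t N :=
  sweep_subset_swept (i := 0) h.pos
    (openSeg_subset_sweep ((t 0).int_subset_carrier h.start) (mem_openSeg_self h.start_notMem))

theorem IsSweepline.sweep_subset (h : IsSweepline J p t N) (i : ℕ) (hi : (i : ℕ∞) < N) :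
    sweep J (t i) ⊆ connectedComponentIn Jᶜ p := by
  induction i using Nat.strong_induction_on with
  | _ i ih =>
    rcases i with _ | i
    · exact sweep_subset_connectedComponentIn (h.disj 0 hi) ((t 0).int_subset_carrier h.start)
        (mem_connectedComponentIn h.start_notMem)
    obtain ⟨v, hv, m, hm, hend, -⟩ := h.step i hi
    have hprev : swept J t (i + 1 : ℕ) ⊆ connectedComponentIn Jᶜ p :=
      iUnion₂_subset fun k hk => ih k (by exact_mod_cast hk) (hk.trans hi)
    have hmU : m ∈ connectedComponentIn Jᶜ p := mem_connectedComponentIn_of_mem_closure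
      (closure_mono hprev (frontier_subset_closure (hv.1 hm))) (disjoint_left.1 hv.2.1 hm)
    have hmt : m ∈ (t (i + 1)).carrier := by
      rcases hend with rfl | rfl
      · exact (t (i + 1)).left_mem_carrier
      · exact (t (i + 1)).right_mem_carrier
    exact sweep_subset_connectedComponentIn (h.disj _ hi) hmt hmU

theorem IsSweepline.swept_subset (h : IsSweepline J p t N) :
    swept J t N ⊆ connectedComponentIn Jᶜ p :=
  iUnion₂_subset h.sweep_subset

end Component

section Gap

theorem exists_lt_exists_isPreconnected_subset_ball {X : Type*} [PseudoMetricSpace X] {J : Set X}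
    [LocallyConnectedSpace J] (hJ : IsCompact J) {z : ℕ → X} (hz : ∀ n, z n ∈ J) {ε : ℝ}
    (hε : 0 < ε) :
    ∃ k l, k < l ∧ ∃ C ⊆ J, IsPreconnected C ∧ z k ∈ C ∧ z l ∈ C ∧ C ⊆ Metric.ball (z l) ε := by
  obtain ⟨a, haJ, φ, hφ, ha⟩ := hJ.tendsto_subseq hz
  have hball : Subtype.val ⁻¹' Metric.ball a (ε / 2) ∈ 𝓝 (⟨a, haJ⟩ : J) :=
    continuous_subtype_val.continuousAt.preimage_mem_nhds (Metric.ball_mem_nhds a (half_pos hε))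
  obtain ⟨V, hVball, hVopen, haV, hVconn⟩ :=
    locallyConnectedSpace_iff_subsets_isOpen_isConnected.1 ‹_› _ _ hball
  have hlim : Tendsto (fun n => (⟨z (φ n), hz (φ n)⟩ : J)) atTop (𝓝 ⟨a, haJ⟩) :=
    tendsto_subtype_rng.2 ha
  obtain ⟨M, hM⟩ := eventually_atTop.1 (hlim.eventually (hVopen.mem_nhds haV))
  refine ⟨φ M, φ (M + 1), hφ M.lt_succ_self, Subtype.val '' V, Subtype.coe_image_subset J V,
    hVconn.isPreconnected.image _ continuous_subtype_val.continuousOn,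
    ⟨_, hM M le_rfl, rfl⟩, ⟨_, hM (M + 1) M.le_succ, rfl⟩, ?_⟩
  rintro _ ⟨v, hv, rfl⟩
  have hva : dist v.1 a < ε / 2 := hVball hv
  have hza : dist (z (φ (M + 1))) a < ε / 2 := hVball (hM (M + 1) M.le_succ)
  rw [Metric.mem_ball]
  linarith [dist_triangle_right v.1 (z (φ (M + 1))) a]

theorem exists_strictMono_monotone_or_antitone {α : Type*} [LinearOrder α] (x : ℕ → α) :
    ∃ φ : ℕ → ℕ, StrictMono φ ∧ (Monotone (x ∘ φ) ∨ Antitone (x ∘ φ)) := by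
  obtain ⟨g, hg⟩ := exists_increasing_or_nonincreasing_subseq (· ≤ ·) x
  refine ⟨g, g.strictMono, hg.imp (fun h => ?_) fun h => ?_⟩
  · exact monotone_nat_of_le_succ fun n => h n (n + 1) n.lt_succ_self
  · exact antitone_nat_of_succ_le fun n => (not_le.1 (h n (n + 1) n.lt_succ_self)).le

theorem exists_strictMono_dist_lt {X : Type*} [PseudoMetricSpace X] [ProperSpace X] {w : ℕ → X}
    (hw : Bornology.IsBounded (range w)) {ε : ℝ} (hε : 0 < ε) :
    ∃ φ : ℕ → ℕ, StrictMono φ ∧ ∀ m n, dist (w (φ m)) (w (φ n)) < ε := by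
  obtain ⟨a, -, φ, hφ, ha⟩ := tendsto_subseq_of_bounded hw mem_range_self
  obtain ⟨M, hM⟩ := Metric.cauchySeq_iff.1 ha.cauchySeq ε hε
  exact ⟨fun n => φ (M + n), hφ.comp (strictMono_id.const_add M),
    fun m n => hM _ (M.le_add_right m) _ (M.le_add_right n)⟩

theorem mem_uIcc_of_monotone_or_antitone {α : Type*} [LinearOrder α] {x z : ℕ → α}
    (hx : Monotone x ∨ Antitone x) (hz : ∀ n, z n ∈ uIcc (x n) (x (n + 1))) {k l : ℕ}
    (hkl : k < l) : x l ∈ uIcc (z k) (z l) := by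
  have hzk := hz k
  have hzl := hz l
  rcases hx with hx | hx
  · rw [uIcc_of_le (hx (Nat.le_succ _))] at hzk hzl
    exact mem_uIcc_of_le (hzk.2.trans (hx hkl)) hzl.1
  · rw [uIcc_of_ge (hx (Nat.le_succ _))] at hzk hzl
    exact mem_uIcc_of_ge hzl.2 ((hx hkl).trans hzk.1)

theorem exists_lt_disjoint_uIcc {J : Set (ℝ × ℝ)} [LocallyConnectedSpace J] (hJ : IsCompact J)
    {w : ℕ → ℝ × ℝ} (hw : Bornology.IsBounded (range w)) {c : ℝ} (hc : 0 < c)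
    (hcol : ∀ k, Disjoint ({(w k).1} ×ˢ Metric.ball (w k).2 c) J) :
    ∃ k l, k < l ∧ Disjoint (uIcc (w k) (w l)) J := by
  obtain ⟨φ, hφ, hclose⟩ := exists_strictMono_dist_lt hw (half_pos hc)
  obtain ⟨ψ, hψ, hmono⟩ := exists_strictMono_monotone_or_antitone fun n => (w (φ n)).1
  set v : ℕ → ℝ × ℝ := fun n => w (φ (ψ n))
  by_contra! hmeet
  have hbetween (n : ℕ) : ∃ z ∈ J, z ∈ uIcc (v n) (v (n + 1)) :=
    (not_disjoint_iff.1 (hmeet _ _ (hφ (hψ n.lt_succ_self)))).imp fun _ => And.symm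
  choose z hzJ hz using hbetween
  -- A small connected piece of `J` joins two of these points, hence crosses the column of `v l`.
  obtain ⟨k, l, hkl, C, hCJ, hC, hkC, hlC, hCball⟩ :=
    exists_lt_exists_isPreconnected_subset_ball hJ hzJ (half_pos hc)
  have hxl : (v l).1 ∈ uIcc (z k).1 (z l).1 :=
    mem_uIcc_of_monotone_or_antitone hmono (fun n => ⟨(hz n).1.1, (hz n).2.1⟩) hkl
  obtain ⟨q, hqC, hqx⟩ := (hC.image _ continuous_fst.continuousOn).ordConnected.uIcc_subset
    (mem_image_of_mem _ hkC) (mem_image_of_mem _ hlC) hxl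
  refine disjoint_left.1 (hcol (φ (ψ l))) ⟨hqx, ?_⟩ (hCJ hqC)
  have hqz : dist q.2 (z l).2 < c / 2 := (le_max_right _ _).trans_lt (hCball hqC)
  have hvz : dist (v l).2 (z l).2 < c / 2 :=
    calc dist (v l).2 (z l).2 ≤ dist (v l).2 (v (l + 1)).2 :=
          Real.dist_left_le_of_mem_uIcc ⟨(hz l).1.2, (hz l).2.2⟩
      _ ≤ dist (v l) (v (l + 1)) := le_max_right _ _
      _ < c / 2 := hclose _ _
  exact (dist_triangle_right q.2 (v l).2 (z l).2).trans_lt (by linarith)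

end Gap

theorem exists_Icc_prod_uIcc_disjoint {J : Set (ℝ × ℝ)} (hJ : IsClosed J) {a b : ℝ × ℝ}
    (hd : Disjoint (uIcc a b) J) :
    ∃ x₁ < min a.1 b.1, ∃ x₂ > max a.1 b.1, Disjoint (Icc x₁ x₂ ×ˢ uIcc a.2 b.2) J := by
  obtain ⟨δ, hδ, hδJ⟩ :=
    (isCompact_Icc : IsCompact (uIcc a b)).exists_cthickening_subset_open hJ.isOpen_compl
      (disjoint_left.1 hd)
  refine ⟨min a.1 b.1 - δ, by linarith, max a.1 b.1 + δ, by linarith,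
    disjoint_left.2 fun q hq => hδJ ?_⟩
  have hclamp : (max (min a.1 b.1) (min q.1 (max a.1 b.1)), q.2) ∈ uIcc a b := by
    rw [uIcc_prod_eq]
    exact ⟨⟨le_max_left _ _, max_le min_le_max (min_le_right _ _)⟩, hq.2⟩
  refine Metric.mem_cthickening_of_dist_le q _ δ _ hclamp ?_
  have hdist : dist q.1 (max (min a.1 b.1) (min q.1 (max a.1 b.1))) ≤ δ := by
    have := min_le_max (a := a.1) (b := b.1)
    rw [Real.dist_eq, abs_le]
    grind
  exact max_le hdist (by simpa using hδ.le)

section Greedy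

variable {J : Set (ℝ × ℝ)} {p : ℝ × ℝ} {t : ℕ → HSeg} {u : ℕ → VSeg} {N : ℕ∞}

/-- The horizontal segment `t` starts at `m` and runs to the right up to a point of `J`. -/
def RunsRight (J : Set (ℝ × ℝ)) (t : HSeg) (m : ℝ × ℝ) : Prop := t.left = m ∧ t.right ∈ J

/-- The horizontal segment `t` starts at `m` and runs to the left up to a point of `J`. -/
def RunsLeft (J : Set (ℝ × ℝ)) (t : HSeg) (m : ℝ × ℝ) : Prop := t.right = m ∧ t.left ∈ J

theorem RunsRight.mem_carrier {t : HSeg} {m : ℝ × ℝ} (h : RunsRight J t m) {x : ℝ}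
    (hx : m.1 ≤ x) (hd : Disjoint (Icc m.1 x ×ˢ {m.2}) J) : (x, m.2) ∈ t.carrier := by
  obtain ⟨rfl, hright⟩ := h
  refine ⟨⟨hx, ?_⟩, rfl⟩
  by_contra! hlt
  exact hd.notMem_of_mem_right hright ⟨⟨t.lt.le, hlt.le⟩, rfl⟩

theorem RunsLeft.mem_carrier {t : HSeg} {m : ℝ × ℝ} (h : RunsLeft J t m) {x : ℝ}
    (hx : x ≤ m.1) (hd : Disjoint (Icc x m.1 ×ˢ {m.2}) J) : (x, m.2) ∈ t.carrier := by
  obtain ⟨rfl, hleft⟩ := h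
  refine ⟨⟨?_, hx⟩, rfl⟩
  by_contra! hlt
  exact hd.notMem_of_mem_right hleft ⟨⟨hlt.le, t.lt.le⟩, rfl⟩

theorem VSeg.midpoint_mem_carrier (v : VSeg) : v.midpoint ∈ v.carrier :=
  ⟨rfl, left_lt_add_div_two.2 v.lt, add_div_two_lt_right.2 v.lt⟩

theorem VSeg.prod_ball_subset_carrier {v : VSeg} {c : ℝ} (hc : 2 * c ≤ v.length) :
    {v.midpoint.1} ×ˢ Metric.ball v.midpoint.2 c ⊆ v.carrier := by
  refine prod_mono subset_rfl ?_
  rw [Real.ball_eq_Ioo]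
  rw [VSeg.length] at hc
  apply Ioo_subset_Ioo <;> dsimp only [VSeg.midpoint] <;> linarith

theorem IsGreedyRun.isSweepline (h : IsGreedyRun J p t u N) : IsSweepline J p t N where
  pos := h.pos
  start := h.start
  disj := h.disj
  step i hi :=
    ⟨u i, h.mem i hi, (u i).midpoint, (u i).midpoint_mem_carrier,
      (h.endpoints i hi).imp And.left And.left, h.outside i hi⟩

theorem IsGreedyRun.not_disjoint_singleton_prod_uIcc (h : IsGreedyRun J p t u N) {i j : ℕ}
    (hij : i ≤ j) (hj : ((j + 1 : ℕ) : ℕ∞) < N)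
    (hb : Bornology.IsBounded (swept J t (j + 1 : ℕ))) {x y z : ℝ} (hy : (x, y) ∈ (t i).carrier)
    (hz : (x, z) ∈ (t (j + 1)).carrier) (hne : x ≠ (u j).midpoint.1) :
    ¬ Disjoint ({x} ×ˢ uIcc y z) J := by
  intro hd
  have hyz : (x, z) ∈ openSeg J (x, y) :=
    mem_openSeg_of_convex ((convex_singleton x).prod (convex_uIcc y z)) hd ⟨rfl, left_mem_uIcc⟩
      ⟨rfl, right_mem_uIcc⟩ rfl
  have hlt : (i : ℕ∞) < (j + 1 : ℕ) := by exact_mod_cast Nat.lt_succ_of_le hij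
  have hswept : (x, z) ∈ swept J t (j + 1 : ℕ) :=
    sweep_subset_swept hlt (openSeg_subset_sweep hy hyz)
  exact disjoint_left.1 (disjoint_exterior_frontier hb) hswept
    (h.outside j hj ⟨hz, fun heq => hne (congrArg Prod.fst heq)⟩)

theorem IsGreedyRun.not_disjoint_uIcc_of_runsRight (hJ : IsClosed J) (h : IsGreedyRun J p t u N)
    {i j : ℕ} (hij : i < j) (hj : ((j + 1 : ℕ) : ℕ∞) < N)
    (hb : Bornology.IsBounded (swept J t (j + 1 : ℕ)))
    (hri : RunsRight J (t (i + 1)) (u i).midpoint)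
    (hrj : RunsRight J (t (j + 1)) (u j).midpoint) :
    ¬ Disjoint (uIcc (u i).midpoint (u j).midpoint) J := by
  intro hd
  obtain ⟨x₁, hx₁, x₂, hx₂, hbox⟩ := exists_Icc_prod_uIcc_disjoint hJ hd
  obtain ⟨hx₁i, hx₁j⟩ := lt_min_iff.1 hx₁
  obtain ⟨hx₂i, hx₂j⟩ := max_lt_iff.1 hx₂
  -- Both segments reach the column `x₂`, where the earlier sweep covers a point of the later one.
  have hmemi := hri.mem_carrier hx₂i.le (hbox.mono_left
    (prod_mono (Icc_subset_Icc_left hx₁i.le) (singleton_subset_iff.2 left_mem_uIcc)))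
  have hmemj := hrj.mem_carrier hx₂j.le (hbox.mono_left
    (prod_mono (Icc_subset_Icc_left hx₁j.le) (singleton_subset_iff.2 right_mem_uIcc)))
  have hx : x₂ ∈ Icc x₁ x₂ := right_mem_Icc.2 (hx₁i.trans hx₂i).le
  exact h.not_disjoint_singleton_prod_uIcc hij hj hb hmemi hmemj hx₂j.ne'
    (hbox.mono_left (prod_mono (singleton_subset_iff.2 hx) subset_rfl))

theorem IsGreedyRun.not_disjoint_uIcc_of_runsLeft (hJ : IsClosed J) (h : IsGreedyRun J p t u N)
    {i j : ℕ} (hij : i < j) (hj : ((j + 1 : ℕ) : ℕ∞) < N)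
    (hb : Bornology.IsBounded (swept J t (j + 1 : ℕ)))
    (hli : RunsLeft J (t (i + 1)) (u i).midpoint)
    (hlj : RunsLeft J (t (j + 1)) (u j).midpoint) :
    ¬ Disjoint (uIcc (u i).midpoint (u j).midpoint) J := by
  intro hd
  obtain ⟨x₁, hx₁, x₂, hx₂, hbox⟩ := exists_Icc_prod_uIcc_disjoint hJ hd
  obtain ⟨hx₁i, hx₁j⟩ := lt_min_iff.1 hx₁
  obtain ⟨hx₂i, hx₂j⟩ := max_lt_iff.1 hx₂
  have hmemi := hli.mem_carrier hx₁i.le (hbox.mono_left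
    (prod_mono (Icc_subset_Icc_right hx₂i.le) (singleton_subset_iff.2 left_mem_uIcc)))
  have hmemj := hlj.mem_carrier hx₁j.le (hbox.mono_left
    (prod_mono (Icc_subset_Icc_right hx₂j.le) (singleton_subset_iff.2 right_mem_uIcc)))
  have hx : x₁ ∈ Icc x₁ x₂ := left_mem_Icc.2 (hx₁i.trans hx₂i).le
  exact h.not_disjoint_singleton_prod_uIcc hij hj hb hmemi hmemj hx₁j.ne
    (hbox.mono_left (prod_mono (singleton_subset_iff.2 hx) subset_rfl))

theorem IsGreedyRun.exists_strictMono_not_disjoint_uIcc (hJ : IsClosed J)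
    (h : IsGreedyRun J p t u ⊤) (hb : Bornology.IsBounded (swept J t ⊤)) :
    ∃ φ : ℕ → ℕ, StrictMono φ ∧
      ∀ k l, k < l → ¬ Disjoint (uIcc (u (φ k)).midpoint (u (φ l)).midpoint) J := by
  have hbn (n : ℕ) : Bornology.IsBounded (swept J t n) := hb.subset (swept_mono le_top)
  have hruns : ∃ᶠ i in atTop,
      RunsRight J (t (i + 1)) (u i).midpoint ∨ RunsLeft J (t (i + 1)) (u i).midpoint :=
    .of_forall fun i => h.endpoints i (ENat.natCast_lt_top _)
  rcases frequently_or_distrib.1 hruns with hright | hleft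
  · obtain ⟨φ, hφ, hφright⟩ := extraction_of_frequently_atTop hright
    exact ⟨φ, hφ, fun k l hkl => h.not_disjoint_uIcc_of_runsRight hJ (hφ hkl)
      (ENat.natCast_lt_top _) (hbn _) (hφright k) (hφright l)⟩
  · obtain ⟨φ, hφ, hφleft⟩ := extraction_of_frequently_atTop hleft
    exact ⟨φ, hφ, fun k l hkl => h.not_disjoint_uIcc_of_runsLeft hJ (hφ hkl)
      (ENat.natCast_lt_top _) (hbn _) (hφleft k) (hφleft l)⟩

theorem IsGreedyRun.midpoint_mem_closure (h : IsGreedyRun J p t u N) {i : ℕ}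
    (hi : ((i + 1 : ℕ) : ℕ∞) < N) : (u i).midpoint ∈ closure (swept J t N) :=
  closure_mono (swept_mono hi.le)
    (frontier_subset_closure ((h.mem i hi).1 (u i).midpoint_mem_carrier))

theorem IsGreedyRun.frequently_length_lt [LocallyConnectedSpace J] (hJ : IsCompact J)
    (h : IsGreedyRun J p t u ⊤) (hb : Bornology.IsBounded (swept J t ⊤)) {c : ℝ} (hc : 0 < c) :
    ∃ᶠ i in atTop, (u i).length < 2 * c := by
  by_contra hlong
  obtain ⟨i₀, hi₀⟩ := eventually_atTop.1 (not_frequently.1 hlong)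
  obtain ⟨φ, hφ, hmeet⟩ := h.exists_strictMono_not_disjoint_uIcc hJ.isClosed hb
  have hge (n : ℕ) : i₀ ≤ φ (i₀ + n) := (i₀.le_add_right n).trans hφ.le_apply
  have hmid : range (fun n => (u (φ (i₀ + n))).midpoint) ⊆ closure (swept J t ⊤) :=
    range_subset_iff.2 fun n => h.midpoint_mem_closure (ENat.natCast_lt_top _)
  obtain ⟨k, l, hkl, hd⟩ := exists_lt_disjoint_uIcc hJ (hb.closure.subset hmid) hc fun n =>
    (h.mem _ (ENat.natCast_lt_top _)).2.1.mono_left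
      (VSeg.prod_ball_subset_carrier (not_lt.1 (hi₀ _ (hge n))))
  exact hmeet _ _ (Nat.add_lt_add_left hkl i₀) hd

theorem IsGreedyRun.frontier_subset_of_finite (hJ : IsClosed J) {n : ℕ}
    (h : IsGreedyRun J p t u n) (hb : Bornology.IsBounded (swept J t n)) :
    frontier (swept J t n) ⊆ J := by
  intro q hq
  by_contra hqJ
  obtain ⟨v, hv, -⟩ := (saturated_swept J t n).exists_verticalSegment hJ hb hq hqJ
  exact notMem_empty v (h.halt n rfl ▸ hv)

theorem IsGreedyRun.frontier_subset_of_infinite [LocallyConnectedSpace J] (hJ : IsCompact J)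
    (h : IsGreedyRun J p t u ⊤) (hb : Bornology.IsBounded (swept J t ⊤)) :
    frontier (swept J t ⊤) ⊆ J := by
  intro q hq
  by_contra hqJ
  obtain ⟨c, hc, hball⟩ := exists_ball_disjoint hJ.isClosed hqJ
  obtain ⟨z, hz, hzq⟩ := Metric.mem_closure_iff.1 (frontier_subset_closure hq) c hc
  obtain ⟨i₀, -, hzi₀⟩ := mem_iUnion₂.1 hz
  obtain ⟨i, hi, hshort⟩ := frequently_atTop.1 (h.frequently_length_lt hJ hb hc) i₀
  have hlt : (i₀ : ℕ∞) < (i + 1 : ℕ) := by exact_mod_cast Nat.lt_succ_of_le hi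
  have hsub : swept J t (i + 1 : ℕ) ⊆ swept J t ⊤ := swept_mono le_top
  have hne : (Metric.ball q c ∩ frontier (swept J t (i + 1 : ℕ))).Nonempty := by
    refine not_disjoint_iff_nonempty_inter.1 fun hd => hq.2 (interior_mono hsub ?_)
    exact subset_interior_of_disjoint_frontier (convex_ball q c).isPreconnected hd
      ⟨z, Metric.mem_ball'.2 hzq, sweep_subset_swept hlt hzi₀⟩ (Metric.mem_ball_self hc)
  obtain ⟨v, hv, hvc⟩ := (saturated_swept J t _).exists_verticalSegment_length_ge hJ.isClosed
    (hb.subset hsub) hc hball hne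
  exact hshort.not_ge (hvc.trans (h.longest i (ENat.natCast_lt_top _) v hv))

theorem IsGreedyRun.frontier_subset [LocallyConnectedSpace J] (hJ : IsCompact J)
    (h : IsGreedyRun J p t u N) (hb : Bornology.IsBounded (swept J t N)) :
    frontier (swept J t N) ⊆ J := by
  induction N using ENat.recTopCoe with
  | coe n => exact h.frontier_subset_of_finite hJ.isClosed hb
  | top => exact h.frontier_subset_of_infinite hJ hb

end Greedy

theorem verticalSegments_self (J : Set (ℝ × ℝ)) : verticalSegments J J = ∅ :=
  eq_empty_of_forall_notMem fun v hv =>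
    disjoint_left.1 hv.2.1 v.midpoint_mem_carrier (hv.1 v.midpoint_mem_carrier)

theorem IsJordanCurve.isPiecewiseVertical {J : Set (ℝ × ℝ)} (hJ : IsJordanCurve J) :
    IsPiecewiseVertical J J :=
  ⟨hJ, subset_union_left⟩

end Sweepline

theorem mainTheorem1 (J : Set (ℝ × ℝ)) (hJ : Sweepline.IsJordanCurve J)
    (p : ℝ × ℝ) (hp : p ∉ J)
    (hfin : ∀ s, Sweepline.SegEquiv J (Sweepline.openSeg J p) s → Bornology.IsBounded s)
    (t : ℕ → Sweepline.HSeg) (u : ℕ → Sweepline.VSeg) (N : ℕ∞)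
    (hrun : Sweepline.IsGreedyRun J p t u N) :
    Sweepline.IsMaximalSweepline J p t N := by
  have hU := Sweepline.isBounded_connectedComponentIn hJ.isCompact hfin
  have hsweep := hrun.isSweepline
  have := hJ.locallyConnectedSpace
  have hfr : frontier (Sweepline.swept J t N) ⊆ J :=
    hrun.frontier_subset hJ.isCompact (hU.subset hsweep.swept_subset)
  have hE : Sweepline.swept J t N = connectedComponentIn Jᶜ p :=
    Sweepline.eq_connectedComponentIn_of_disjoint_frontier hsweep.mem_swept hsweep.swept_subset
      (disjoint_compl_left.mono_right hfr)
  have hK : Sweepline.boundary J t N = J := by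
    refine hfr.antisymm (hJ.subset_frontier ?_ ?_ ⟨p, hsweep.mem_swept⟩ hfr) <;> rw [hE]
    · exact Set.disjoint_left.2 (connectedComponentIn_subset Jᶜ p)
    · exact hU
  refine ⟨hsweep, ⟨⟨t, N, hsweep, rfl⟩, ?_⟩, ?_, ?_⟩
  · rintro _ ⟨t', N', hsweep', rfl⟩ -
    exact hsweep'.swept_subset.trans hE.ge
  · exact hK.symm ▸ hJ.isPiecewiseVertical
  · exact hK.symm ▸ Sweepline.verticalSegments_self J
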